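/- All graphs are simple and undirected. The line graph $L(G)$ of a graph $G$ has the edges of $G$ as its vertices, two of them being adjacent if they are distinct and share an endpoint; $L^0(G)=G$ and $L^{k+1}(G)=L(L^k(G))$. A graph is called prolific if it is finite and connected and is not isomorphic to a path $P_n$ ($n\ge 1$), a cycle $C_n$ ($n\ge 3$), or the star $K_{1,3}$. Let $\chi$ denote the chromatic number, put $\mathrm{ind}(\chi,G)=\min\{r : \chi(G)<\chi(L^r(G))\}$, and let $k(\chi,\mathcal F)=\max\{\mathrm{ind}(\chi,G) : G\in\mathcal F\}$, where $\mathcal F$ is the family of all prolific graphs (a minimum over the empty set, and a maximum that does not exist, are read as $\infty$). For $k\ge 3$ and $l\ge 1$ let $CP(k,l)$ be the graph on $k+l$ vertices obtained from a cycle $C_k$ by attaching a path of length $l$ at one of its vertices. Theorem H. Every prolific graph $G$ satisfies $\mathrm{ind}(\chi,G)\le 3$. For every $n\ge 4$ the graph $CP(3,n-3)$ is prolific and $\mathrm{ind}(\chi,CP(3,n-3))=3$; in particular there are infinitely many pairwise non-isomorphic prolific graphs $G$ with $\mathrm{ind}(\chi,G)=3$. Hence $k(\chi,\mathcal F)=3$.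 -/

import Mathlib

universe u

namespace LineIndex

/-- A simple graph bundled with its vertex type. -/
abbrev Graph : Type (u + 1) := Σ V : Type u, SimpleGraph V

/-- The iterated line graph: `L^0(G) = G` and `L^(k+1)(G) = L(L^k(G))`. -/
def iterLine (G : Graph.{u}) : ℕ → Graph.{u}
  | 0 => G
  | k + 1 => ⟨(iterLine G k).2.edgeSet, (iterLine G k).2.lineGraph⟩

/-- A finite connected simple graph that is not isomorphic to a path, to a cycle, or to `K_{1,3}`. -/
def IsProlific {V : Type u} (G : SimpleGraph V) : Prop :=
  Finite V ∧ G.Connected ∧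
    (∀ n : ℕ, IsEmpty (G ≃g SimpleGraph.pathGraph n)) ∧
    (∀ n : ℕ, 3 ≤ n → IsEmpty (G ≃g SimpleGraph.cycleGraph n)) ∧
    IsEmpty (G ≃g completeBipartiteGraph (Fin 1) (Fin 3))

/-- The family of all prolific graphs. -/
def prolificGraphs : Set Graph.{u} := {G | IsProlific G.2}

/-- `ind(P, G) = min {r : P(G) < P(L^r(G))}`, with value `⊤` if there is no such `r`. -/
noncomputable def ind (P : Graph.{u} → ℕ∞) (G : Graph.{u}) : ℕ∞ :=
  sInf ((fun r : ℕ => (r : ℕ∞)) '' {r : ℕ | P G < P (iterLine G r)})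

/-- The index `k(P, F)` of a family: the maximum of `ind(P, G)` over `G ∈ F`, and `⊤` if the
indices are unbounded or some index is infinite. (In `ℕ∞` a supremum of a nonempty set that is
not `⊤` is attained.) -/
noncomputable def familyIndex (P : Graph.{u} → ℕ∞) (F : Set Graph.{u}) : ℕ∞ :=
  ⨆ G ∈ F, ind P G

/-- The chromatic number as a graph parameter. -/
noncomputable def chi (G : Graph.{u}) : ℕ∞ := G.2.chromaticNumber

/-- `CP(k, l)` for `k ≥ 3`: the path `0, 1, …, k + l - 1` together with the edge joining `0` and
`k - 1`. So `0, …, k - 1` is a `k`-cycle, to whose vertex `k - 1` a path of length `l` is attached. -/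
def CP (k l : ℕ) : SimpleGraph (Fin (k + l)) :=
  SimpleGraph.fromRel fun i j =>
    (i : ℕ) + 1 = (j : ℕ) ∨ ((i : ℕ) = 0 ∧ (j : ℕ) + 1 = k)

end LineIndex

namespace LineIndex

open SimpleGraph

section Closed

variable {V : Type*} {G : SimpleGraph V}

/-! A prolific graph has a vertex of degree at least 3, being neither a path nor a cycle. If χ = c <
3, the edges at such a vertex are a clique of size at least 3 in L(G). If c ≥ 3, greedy colouring
fails with c - 1 colours, so some induced subgraph S has minimum degree at least c - 1 ≥ 2. By
connectivity S contains a vertex v of degree at least max(3, c - 1) in G. Two edges from v inside S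
form an edge of L(G) whose degree in L²(G) is large enough to give a clique of size c + 1 in L³(G).
For sharpness, CP(3, l) contains a triangle, while explicit 3-colourings of its first two line
graphs exclude r = 1, 2. -/

theorem mem_of_connected_of_closed (hG : G.Connected) {S : Set V} (hS : S.Nonempty)
    (hcl : ∀ v ∈ S, ∀ w, G.Adj v w → w ∈ S) (w : V) : w ∈ S := by
  obtain ⟨v, hv⟩ := hS
  obtain ⟨p⟩ := hG.preconnected v w
  induction p with
  | nil => exact hv
  | cons h _ ih => exact ih (hcl _ hv _ h)

end Closed

/-! ### Degrees and cliques in iterated line graphs -/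

section Degree

variable {V : Type*} {G : SimpleGraph V}

/-- The edges at a vertex form a clique of the line graph. -/
theorem ncard_neighborSet_le_chromaticNumber_lineGraph (v : V) :
    ((G.neighborSet v).ncard : ℕ∞) ≤ G.lineGraph.chromaticNumber := by
  refine le_chromaticNumber_of_pairwise_adj (ι := G.neighborSet v)
    (le_of_eq (Nat.card_coe_set_eq _).symm)
    (fun w => ⟨s(v, w), w.2⟩) ?_
  intro a b hab
  refine lineGraph_adj_iff_exists.2 ⟨?_, v, by simp, by simp⟩
  intro h
  exact hab (Subtype.ext (Sym2.congr_right.1 (congrArg Subtype.val h)))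

/-- An edge `uv` has degree at least `deg u + deg v - 2` in the line graph. -/
theorem ncard_add_ncard_le_lineGraph [Finite V] {u v : V} (h : G.Adj u v) :
    (G.neighborSet u).ncard + (G.neighborSet v).ncard ≤
      (G.lineGraph.neighborSet ⟨s(u, v), h⟩).ncard + 2 := by
  classical
  set A := G.neighborSet u \ {v}
  set B := G.neighborSet v \ {u}
  have hA : A.ncard + 1 = (G.neighborSet u).ncard := Set.ncard_sdiff_singleton_add_one h
  have hB : B.ncard + 1 = (G.neighborSet v).ncard := Set.ncard_sdiff_singleton_add_one h.symm
  have hA' : ((fun w => s(u, w)) '' A).ncard = A.ncard :=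
    Set.ncard_image_of_injective _ fun _ _ => Sym2.congr_right.1
  have hB' : ((fun w => s(v, w)) '' B).ncard = B.ncard :=
    Set.ncard_image_of_injective _ fun _ _ => Sym2.congr_right.1
  have hdisj : Disjoint ((fun w => s(u, w)) '' A) ((fun w => s(v, w)) '' B) := by
    rw [Set.disjoint_left]
    rintro _ ⟨a, ha, rfl⟩ ⟨b, hb, hab⟩
    rcases Sym2.eq_iff.1 hab with ⟨h1, -⟩ | ⟨h1, -⟩
    · exact h.ne h1.symm
    · exact ha.2 h1.symm
  have hsub : ((fun w => s(u, w)) '' A) ∪ ((fun w => s(v, w)) '' B) ⊆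
      Subtype.val '' (G.lineGraph.neighborSet ⟨s(u, v), h⟩) := by
    rintro _ (⟨a, ha, rfl⟩ | ⟨a, ha, rfl⟩)
    · refine ⟨⟨s(u, a), ha.1⟩, lineGraph_adj_iff_exists.2 ⟨fun he => ?_, u, by simp, by simp⟩, rfl⟩
      exact ha.2 (Sym2.congr_right.1 (congrArg Subtype.val he)).symm
    · refine ⟨⟨s(v, a), ha.1⟩, lineGraph_adj_iff_exists.2 ⟨fun he => ?_, v, by simp, by simp⟩, rfl⟩
      have he' : s(u, v) = s(v, a) := congrArg Subtype.val he
      rw [Sym2.eq_swap] at he'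
      exact ha.2 (Sym2.congr_right.1 he').symm
  have hle := Set.ncard_le_ncard hsub (Set.toFinite _)
  rw [Set.ncard_union_eq hdisj (Set.toFinite _) (Set.toFinite _),
    Set.ncard_image_of_injective _ Subtype.val_injective] at hle
  omega

/-- The edges va and vb have degree at least p + q - 2 in L(G), so the pair they form has degree at
least 2(p + q - 2) - 2 in L²(G), and its edges there are a clique of L³(G). -/
theorem le_chromaticNumber_lineGraph_lineGraph_lineGraph [Finite V] {v a b : V} (hab : a ≠ b)
    (ha : G.Adj v a) (hb : G.Adj v b) {p q : ℕ} (hp : p ≤ (G.neighborSet v).ncard)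
    (hqa : q ≤ (G.neighborSet a).ncard) (hqb : q ≤ (G.neighborSet b).ncard) {n : ℕ}
    (hn : n + 6 ≤ 2 * (p + q)) :
    (n : ℕ∞) ≤ G.lineGraph.lineGraph.lineGraph.chromaticNumber := by
  have h1 := ncard_add_ncard_le_lineGraph ha
  have h2 := ncard_add_ncard_le_lineGraph hb
  have hadj : G.lineGraph.Adj ⟨s(v, a), ha⟩ ⟨s(v, b), hb⟩ :=
    lineGraph_adj_iff_exists.2
      ⟨fun he => hab (Sym2.congr_right.1 (congrArg Subtype.val he)), v, by simp, by simp⟩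
  have h3 := ncard_add_ncard_le_lineGraph hadj
  refine le_trans ?_ (ncard_neighborSet_le_chromaticNumber_lineGraph
    (G := G.lineGraph.lineGraph) ⟨s(⟨s(v, a), ha⟩, ⟨s(v, b), hb⟩), hadj⟩)
  exact_mod_cast (by omega)

end Degree

/-! ### Greedy colouring -/

section Degenerate

variable {V : Type*} {G : SimpleGraph V}

/-- Greedy colouring of a graph each of whose nonempty induced subgraphs has a vertex of degree
less than `k`. -/
theorem colorable_of_forall_exists_ncard_lt [Finite V] {k : ℕ}
    (h : ∀ S : Finset V, S.Nonempty → ∃ v ∈ S, (G.neighborSet v ∩ S).ncard < k) :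
    G.Colorable k := by
  classical
  cases nonempty_fintype V
  rcases isEmpty_or_nonempty V with hV | ⟨⟨v₀⟩⟩
  · exact Colorable.of_isEmpty k
  have hk : 0 < k := by
    obtain ⟨v, -, hv⟩ := h {v₀} (by simp)
    omega
  -- The colouring is total but only required to be proper on S, so a removed vertex can simply be
  -- recoloured.
  have key : ∀ n : ℕ, ∀ S : Finset V, S.card = n →
      ∃ f : V → Fin k, ∀ a ∈ S, ∀ b ∈ S, G.Adj a b → f a ≠ f b := by
    intro n
    induction n with
    | zero =>
      intro S hS
      rw [Finset.card_eq_zero] at hS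
      subst hS
      exact ⟨fun _ => ⟨0, hk⟩, by simp⟩
    | succ n ih =>
      intro S hS
      obtain ⟨v, hv, hlt⟩ := h S (Finset.card_pos.1 (by omega))
      obtain ⟨f, hf⟩ := ih (S.erase v) (by rw [Finset.card_erase_of_mem hv]; omega)
      have hc : (f '' (G.neighborSet v ∩ S)).ncard < k :=
        (Set.ncard_image_le (Set.toFinite _)).trans_lt hlt
      obtain ⟨c, hcn⟩ : ∃ c, c ∉ f '' (G.neighborSet v ∩ S) := by
        by_contra! hall
        rw [Set.eq_univ_of_forall hall, Set.ncard_univ, Nat.card_eq_fintype_card,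
          Fintype.card_fin] at hc
        exact hc.false
      refine ⟨Function.update f v c, fun a ha b hb hab => ?_⟩
      by_cases hav : a = v
      · subst hav
        rw [Function.update_self, Function.update_of_ne hab.ne']
        exact fun hcb => hcn ⟨b, ⟨hab, hb⟩, hcb.symm⟩
      · by_cases hbv : b = v
        · subst hbv
          rw [Function.update_self, Function.update_of_ne hav]
          exact fun hcb => hcn ⟨a, ⟨hab.symm, ha⟩, hcb⟩
        · rw [Function.update_of_ne hav, Function.update_of_ne hbv]
          exact hf a (Finset.mem_erase.2 ⟨hav, ha⟩) b (Finset.mem_erase.2 ⟨hbv, hb⟩) hab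
  obtain ⟨f, hf⟩ := key _ Finset.univ rfl
  exact ⟨Coloring.mk f fun {a b} hab => hf a (Finset.mem_univ _) b (Finset.mem_univ _) hab⟩

end Degenerate

/-! ### Connected graphs of maximum degree two -/

section PathOrCycle

variable {V : Type*} {G : SimpleGraph V}

/-- A finite connected graph with at most two neighbours at each vertex is a path or a cycle. -/
theorem iso_pathGraph_or_iso_cycleGraph [Finite V] (hG : G.Connected)
    (hdeg : ∀ v a b c, G.Adj v a → G.Adj v b → G.Adj v c → a = b ∨ a = c ∨ b = c) :
    (∃ n, Nonempty (G ≃g pathGraph n)) ∨ ∃ n, 3 ≤ n ∧ Nonempty (G ≃g cycleGraph n) := by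
  classical
  cases nonempty_fintype V
  obtain ⟨v₀⟩ := hG.nonempty
  -- A path with n edges, not necessarily induced; a longest one will exhaust V.
  let P : ℕ → Prop := fun n => ∃ f : Fin (n + 1) → V, Function.Injective f ∧
    ∀ i j : Fin (n + 1), (i : ℕ) + 1 = j → G.Adj (f i) (f j)
  have hP0 : P 0 := ⟨fun _ => v₀, fun _ _ _ => Subsingleton.elim (α := Fin 1) _ _, by omega⟩
  have hbound : ∀ n, P n → n ≤ Fintype.card V := by
    rintro n ⟨f, hf, -⟩
    have := Fintype.card_le_of_injective f hf
    rw [Fintype.card_fin] at this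
    omega
  obtain ⟨n, hn, hmax⟩ : ∃ n, P n ∧ ¬ P (n + 1) := by
    by_contra! hall
    have : ∀ n, P n := fun n => by
      induction n with
      | zero => exact hP0
      | succ n ih => exact hall n ih
    have := hbound _ (this (Fintype.card V + 1))
    omega
  obtain ⟨f, hf, hadj⟩ := hn
  have hinner : ∀ i : Fin (n + 1), 0 < (i : ℕ) → (i : ℕ) < n → ∀ w, G.Adj (f i) w →
      ∃ j : Fin (n + 1), ((j : ℕ) + 1 = i ∨ (i : ℕ) + 1 = j) ∧ f j = w := by
    intro i h0 h1 w hw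
    have hl := (hadj ⟨i - 1, by omega⟩ i (by simp; omega)).symm
    have hr := hadj i ⟨i + 1, by omega⟩ rfl
    rcases hdeg _ _ _ _ hl hr hw with h | h | h
    · have := congrArg Fin.val (hf h)
      simp at this
    · exact ⟨_, Or.inl (by simp; omega), h⟩
    · exact ⟨_, Or.inr rfl, h⟩
  -- Inner vertices have both neighbours on the path; a new neighbour of an end would extend it.
  have hrange : ∀ i w, G.Adj (f i) w → w ∈ Set.range f := by
    intro i w hw
    by_contra hnot
    have hnot' : ∀ j, f j ≠ w := fun j hj => hnot ⟨j, hj⟩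
    rcases Nat.eq_zero_or_pos (i : ℕ) with h0 | h0
    · have hi : i = 0 := Fin.ext h0
      subst hi
      refine hmax ⟨Fin.cons w f, Fin.cons_injective_iff.2 ⟨hnot, hf⟩, fun a b hab => ?_⟩
      induction b using Fin.cases with
      | zero => simp at hab
      | succ b =>
        induction a using Fin.cases with
        | zero =>
          have hb : b = 0 := Fin.ext (by simpa using hab.symm)
          subst hb
          simpa using hw.symm
        | succ a => simpa using hadj a b (by simpa using hab)
    · rcases Nat.lt_or_ge (i : ℕ) n with h1 | h1
      · obtain ⟨j, -, hj⟩ := hinner i h0 h1 w hw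
        exact hnot' j hj
      · have hi : i = Fin.last n := Fin.ext (by simp; omega)
        subst hi
        refine hmax ⟨Fin.snoc f w, Fin.snoc_injective_iff.2 ⟨hf, hnot⟩, fun a b hab => ?_⟩
        induction a using Fin.lastCases with
        | last => have := b.2; simp at hab; omega
        | cast a =>
          induction b using Fin.lastCases with
          | last =>
            have ha : a = Fin.last n := Fin.ext (by simpa using hab)
            subst ha
            simpa using hw
          | cast b => simpa using hadj a b (by simpa using hab)
  have hsurj : Function.Surjective f := fun w =>
    mem_of_connected_of_closed (S := Set.range f) hG ⟨f 0, 0, rfl⟩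
      (by rintro _ ⟨i, rfl⟩ w hw; exact hrange i w hw) w
  let e : Fin (n + 1) ≃ V := Equiv.ofBijective f ⟨hf, hsurj⟩
  have hcases : ∀ i j : Fin (n + 1), (i : ℕ) < j → G.Adj (f i) (f j) →
      (i : ℕ) + 1 = j ∨ ((i : ℕ) = 0 ∧ (j : ℕ) = n) := by
    intro i j hij h
    by_contra! hc
    rcases Nat.eq_zero_or_pos (i : ℕ) with h0 | h0
    · have hjn : (j : ℕ) < n := lt_of_le_of_ne (by omega) (hc.2 h0)
      obtain ⟨k, hk, hk'⟩ := hinner j (by omega) hjn _ h.symm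
      have := hf hk'
      subst this
      omega
    · obtain ⟨k, hk, hk'⟩ := hinner i h0 (by omega) _ h
      have := hf hk'
      subst this
      omega
  -- For n = 1 the ends are adjacent too, but the graph is a path, hence 2 ≤ n.
  by_cases hends : 2 ≤ n ∧ G.Adj (f 0) (f (Fin.last n))
  · right
    refine ⟨n + 1, by omega, ⟨(RelIso.symm ⟨e, fun {i j} => ?_⟩)⟩⟩
    change G.Adj (f i) (f j) ↔ _
    wlog hij : (i : ℕ) < j generalizing i j
    · rcases Nat.lt_or_ge (j : ℕ) i with h | h
      · rw [G.adj_comm, (cycleGraph _).adj_comm]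
        exact this h
      · have : i = j := Fin.ext (by omega)
        subst this
        simp
    rw [cycleGraph_adj', Fin.coe_sub_iff_lt.2 hij, Fin.coe_sub_iff_le.2 hij.le]
    constructor
    · intro h
      rcases hcases i j hij h with h | ⟨h, h'⟩ <;> omega
    · intro h
      rcases h with h | h
      · have h1 : i = 0 := Fin.ext (by rw [Fin.val_zero]; omega)
        have h2 : j = Fin.last n := Fin.ext (by simp; omega)
        rw [h1, h2]
        exact hends.2
      · exact hadj i j (by omega)
  · left
    refine ⟨n + 1, ⟨(RelIso.symm ⟨e, fun {i j} => ?_⟩)⟩⟩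
    change G.Adj (f i) (f j) ↔ _
    wlog hij : (i : ℕ) < j generalizing i j
    · rcases Nat.lt_or_ge (j : ℕ) i with h | h
      · rw [G.adj_comm, (pathGraph _).adj_comm]
        exact this h
      · have : i = j := Fin.ext (by omega)
        subst this
        simp
    rw [pathGraph_adj]
    constructor
    · intro h
      rcases hcases i j hij h with h1 | ⟨h1, h2⟩
      · exact Or.inl h1
      · by_cases hn : 2 ≤ n
        · have h1 : i = 0 := Fin.ext h1
          have h2 : j = Fin.last n := Fin.ext h2
          rw [h1, h2] at h
          exact (hends ⟨hn, h⟩).elim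
        · omega
    · rintro (h | h)
      · exact hadj i j h
      · omega

end PathOrCycle

/-! ### The bound ind ≤ 3 -/

section UpperBound

theorem ind_le_of_lt {P : Graph.{u} → ℕ∞} {G : Graph.{u}} {r : ℕ} (h : P G < P (iterLine G r)) :
    ind P G ≤ r :=
  sInf_le ⟨r, h, rfl⟩

variable {V : Type u} {G : SimpleGraph V}

theorem IsProlific.exists_three_le_ncard (h : IsProlific G) :
    ∃ v, 3 ≤ (G.neighborSet v).ncard := by
  obtain ⟨hfin, hconn, hpath, hcycle, -⟩ := h
  by_contra! hlt
  have hdeg : ∀ v a b c, G.Adj v a → G.Adj v b → G.Adj v c → a = b ∨ a = c ∨ b = c := by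
    intro v a b c ha hb hc
    by_contra! hne
    exact (hlt v).not_ge
      ((Set.two_lt_ncard_iff (Set.toFinite _)).2 ⟨a, b, c, ha, hb, hc, hne.1, hne.2.1, hne.2.2⟩)
  rcases iso_pathGraph_or_iso_cycleGraph hconn hdeg with ⟨n, ⟨e⟩⟩ | ⟨n, hn, ⟨e⟩⟩
  · exact (hpath n).false e
  · exact (hcycle n hn).false e

/-- A subgraph of minimum degree at least two in a connected graph with a vertex of degree at
least three contains a vertex whose degree in the whole graph is at least three. -/
theorem exists_mem_three_le_ncard [Finite V] (hG : G.Connected) {S : Set V} (hS : S.Nonempty)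
    (hmin : ∀ v ∈ S, 2 ≤ (G.neighborSet v ∩ S).ncard) {x : V}
    (hx : 3 ≤ (G.neighborSet x).ncard) : ∃ v ∈ S, 3 ≤ (G.neighborSet v).ncard := by
  by_contra! hlt
  -- Each vertex of S has degree at most 2 and already two neighbours in S, so no edge leaves S.
  have hcl : ∀ v ∈ S, ∀ w, G.Adj v w → w ∈ S := by
    intro v hv w hw
    have heq : G.neighborSet v ∩ S = G.neighborSet v :=
      Set.eq_of_subset_of_ncard_le Set.inter_subset_left
        ((Nat.lt_succ_iff.1 (hlt v hv)).trans (hmin v hv)) (Set.toFinite _)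
    exact (heq.ge hw : w ∈ G.neighborSet v ∩ S).2
  exact (hlt x (mem_of_connected_of_closed hG hS hcl x)).not_ge hx

theorem IsProlific.ind_chi_le_three (h : IsProlific G) : ind chi ⟨V, G⟩ ≤ 3 := by
  have hfin := h.1
  have hconn := h.2.1
  obtain ⟨x, hx⟩ := h.exists_three_le_ncard
  have hcol := colorable_chromaticNumber_of_fintype G
  obtain ⟨c, hc⟩ : ∃ c : ℕ, G.chromaticNumber = c :=
    ⟨_, (ENat.natCast_toNat (chromaticNumber_ne_top_iff_exists.2 ⟨_, hcol⟩)).symm⟩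
  rcases Nat.lt_or_ge c 3 with hc3 | hc3
  · refine (ind_le_of_lt (r := 1) ?_).trans (by norm_num)
    change G.chromaticNumber < G.lineGraph.chromaticNumber
    rw [hc]
    refine lt_of_lt_of_le ?_ (ncard_neighborSet_le_chromaticNumber_lineGraph x)
    exact_mod_cast hc3.trans_le hx
  · refine ind_le_of_lt (r := 3) ?_
    change G.chromaticNumber < G.lineGraph.lineGraph.lineGraph.chromaticNumber
    rw [hc]
    obtain ⟨S, hS, hmin⟩ : ∃ S : Finset V, S.Nonempty ∧
        ∀ v ∈ S, c - 1 ≤ (G.neighborSet v ∩ S).ncard := by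
      by_contra! hno
      have := (colorable_of_forall_exists_ncard_lt hno).chromaticNumber_le
      rw [hc] at this
      have : c ≤ c - 1 := by exact_mod_cast this
      omega
    have hdeg : ∀ v ∈ S, c - 1 ≤ (G.neighborSet v).ncard := fun v hv =>
      (hmin v hv).trans (Set.ncard_le_ncard Set.inter_subset_left (Set.toFinite _))
    obtain ⟨v, hv, hv3⟩ := exists_mem_three_le_ncard hconn (S := S) hS
      (fun v hv => le_trans (by omega) (hmin v hv)) hx
    obtain ⟨a, b, ha, hb, hab⟩ := (Set.one_lt_ncard_iff (Set.toFinite _)).1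
      (lt_of_lt_of_le (by omega) (hmin v hv) : 1 < (G.neighborSet v ∩ S).ncard)
    -- With p = max(3, c - 1) and q = c - 1, the bound 2(p + q) - 6 is exactly c + 1 = 4 at c = 3,
    -- where the 3 is needed; for c ≥ 4 it is 4c - 10 ≥ c + 1.
    refine lt_of_lt_of_le ?_ (le_chromaticNumber_lineGraph_lineGraph_lineGraph (n := c + 1) hab
      ha.1 hb.1 (max_le hv3 (hdeg v hv)) (hdeg a ha.2) (hdeg b hb.2) (by omega))
    exact_mod_cast Nat.lt_succ_self c

end UpperBound

/-! ### Sharpness: triangles with a tail -/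

section CP

variable {l : ℕ}

theorem CP_three_adj {i j : Fin (3 + l)} :
    (CP 3 l).Adj i j ↔ (i : ℕ) + 1 = j ∨ (j : ℕ) + 1 = i ∨
      ((i : ℕ) = 0 ∧ (j : ℕ) = 2) ∨ ((j : ℕ) = 0 ∧ (i : ℕ) = 2) := by
  rw [CP, fromRel_adj, ne_eq, Fin.ext_iff]
  omega

theorem CP_three_connected : (CP 3 l).Connected := by
  have h : (pathGraph (2 + l + 1)).Connected := pathGraph_connected _
  have hl : 2 + l + 1 = 3 + l := by omega
  rw [hl] at h
  refine h.mono fun i j hij => ?_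
  rw [pathGraph_adj] at hij
  rw [CP_three_adj]
  omega

theorem CP_three_isProlific (hl : 1 ≤ l) : IsProlific (CP 3 l) := by
  let v : Fin (3 + l) := ⟨2, by omega⟩
  let a : Fin (3 + l) := ⟨0, by omega⟩
  let b : Fin (3 + l) := ⟨1, by omega⟩
  let c : Fin (3 + l) := ⟨3, by omega⟩
  have hva : (CP 3 l).Adj v a := CP_three_adj.2 (by simp [v, a])
  have hvb : (CP 3 l).Adj v b := CP_three_adj.2 (by simp [v, b])
  have hvc : (CP 3 l).Adj v c := CP_three_adj.2 (by simp [v, c])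
  have hab' : (CP 3 l).Adj a b := CP_three_adj.2 (by simp [a, b])
  have hab : a ≠ b := hab'.ne
  have hac : a ≠ c := by simp [a, c]
  have hbc : b ≠ c := by simp [b, c]
  refine ⟨inferInstance, CP_three_connected, fun n => ⟨fun e => ?_⟩, fun n hn => ⟨fun e => ?_⟩,
    ⟨fun e => ?_⟩⟩
  · have h1 := pathGraph_adj.1 (e.map_adj_iff.2 hva)
    have h2 := pathGraph_adj.1 (e.map_adj_iff.2 hvb)
    have h3 := pathGraph_adj.1 (e.map_adj_iff.2 hvc)
    have h4 := Fin.val_ne_of_ne (e.injective.ne hab)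
    have h5 := Fin.val_ne_of_ne (e.injective.ne hac)
    have h6 := Fin.val_ne_of_ne (e.injective.ne hbc)
    omega
  · obtain ⟨m, rfl⟩ : ∃ m, n = m + 2 := ⟨n - 2, by omega⟩
    have hN : ∀ x, (CP 3 l).Adj v x → e x = e v - 1 ∨ e x = e v + 1 := fun x hx => by
      have : e x ∈ (cycleGraph (m + 2)).neighborSet (e v) := e.map_adj_iff.2 hx
      rwa [cycleGraph_neighborSet] at this
    have h4 := e.injective.ne hab
    have h5 := e.injective.ne hac
    have h6 := e.injective.ne hbc
    rcases hN a hva with h1 | h1 <;> rcases hN b hvb with h2 | h2 <;>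
      rcases hN c hvc with h3 | h3 <;> simp_all
  -- A bipartite graph has no triangle.
  · have h1 := e.map_adj_iff.2 hva
    have h2 := e.map_adj_iff.2 hvb
    have h3 := e.map_adj_iff.2 hab'
    rw [completeBipartiteGraph_adj] at h1 h2 h3
    cases hev : e v <;> cases hea : e a <;> cases heb : e b <;> simp_all

theorem three_le_chromaticNumber_CP_three : 3 ≤ (CP 3 l).chromaticNumber := by
  refine le_chromaticNumber_of_pairwise_adj (ι := Fin 3) (n := 3) (by simp)
    (fun i => Fin.castLE (by omega) i) fun i j hij => ?_
  have := Fin.val_ne_of_ne hij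
  change (CP 3 l).Adj _ _
  rw [CP_three_adj, Fin.val_castLE, Fin.val_castLE]
  omega

/-- The sum of the endpoints of an edge of `CP(3, l)`; it determines the edge. -/
def edgeSum (e : (CP 3 l).edgeSet) : ℕ :=
  Sym2.lift ⟨fun i j : Fin (3 + l) => (i : ℕ) + j, fun _ _ => Nat.add_comm _ _⟩ e.1

/-- The labelling `0, 1, 2, 3, 4, …` of the edges `01, 02, 12, 23, 34, …` of `CP(3, l)`. -/
def edgeIndex (e : (CP 3 l).edgeSet) : ℕ :=
  if edgeSum e ≤ 2 then edgeSum e - 1 else (edgeSum e + 1) / 2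

theorem edgeIndex_cases {i j : Fin (3 + l)} (h : (CP 3 l).Adj i j) :
    ((i : ℕ) + j ≤ 2 ∧ edgeIndex ⟨s(i, j), h⟩ + 1 = i + j) ∨
      (2 < (i : ℕ) + j ∧ 2 * edgeIndex ⟨s(i, j), h⟩ = i + j + 1) := by
  have hij := CP_three_adj.1 h
  have hsum : edgeSum ⟨s(i, j), h⟩ = i + j := rfl
  rw [edgeIndex, hsum]
  split_ifs <;> omega

theorem edgeIndex_injective : Function.Injective (edgeIndex (l := l)) := by
  rintro ⟨e, he⟩ ⟨e', he'⟩ h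
  induction e using Sym2.ind with | _ i j
  induction e' using Sym2.ind with | _ i' j'
  have h1 := CP_three_adj.1 ((mem_edgeSet _).1 he)
  have h2 := CP_three_adj.1 ((mem_edgeSet _).1 he')
  have h3 := edgeIndex_cases ((mem_edgeSet _).1 he)
  have h4 := edgeIndex_cases ((mem_edgeSet _).1 he')
  simp only [Subtype.mk.injEq, Sym2.eq_iff, Fin.ext_iff]
  omega

theorem edgeIndex_of_adj {e e' : (CP 3 l).edgeSet} (h : (CP 3 l).lineGraph.Adj e e') :
    edgeIndex e + 1 = edgeIndex e' ∨ edgeIndex e' + 1 = edgeIndex e ∨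
      (edgeIndex e + 2 = edgeIndex e' ∧ edgeIndex e ≤ 1) ∨
      (edgeIndex e' + 2 = edgeIndex e ∧ edgeIndex e' ≤ 1) := by
  have hne := edgeIndex_injective.ne h.ne
  obtain ⟨-, v, hv, hv'⟩ := lineGraph_adj_iff_exists.1 h
  obtain ⟨e, he⟩ := e
  obtain ⟨e', he'⟩ := e'
  obtain ⟨j, rfl⟩ := Sym2.mem_iff_exists.1 hv
  obtain ⟨j', rfl⟩ := Sym2.mem_iff_exists.1 hv'
  have h1 := CP_three_adj.1 ((mem_edgeSet _).1 he)
  have h2 := CP_three_adj.1 ((mem_edgeSet _).1 he')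
  have h3 := edgeIndex_cases ((mem_edgeSet _).1 he)
  have h4 := edgeIndex_cases ((mem_edgeSet _).1 he')
  omega

/-- Adjacent labels differ by 1 or 2, hence modulo 3. -/
theorem colorable_lineGraph_CP_three : (CP 3 l).lineGraph.Colorable 3 := by
  refine ⟨Coloring.mk (fun e => ⟨edgeIndex e % 3, Nat.mod_lt _ (by norm_num)⟩) fun {e e'} h => ?_⟩
  have := edgeIndex_of_adj h
  rw [ne_eq, Fin.ext_iff]
  simp only
  omega

/-- Colours consecutive pairs `{m, m + 1}` by the parity of `m`, and all other pairs by `2`. -/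
def pairColor (m n : ℕ) : ℕ :=
  if m + 1 = n ∨ n + 1 = m then min m n % 2 else 2

theorem pairColor_comm (m n : ℕ) : pairColor m n = pairColor n m := by
  simp only [pairColor, min_comm m n, or_comm (a := m + 1 = n)]

theorem pairColor_lt (m n : ℕ) : pairColor m n < 3 := by
  rw [pairColor]
  split_ifs <;> omega

/-- The edges of L(CP(3, l)) are consecutive pairs, alternating in colour, and possibly {0, 2} and
{1, 3}, which are disjoint and so can share the third colour. -/
theorem colorable_lineGraph_lineGraph_CP_three :
    (CP 3 l).lineGraph.lineGraph.Colorable 3 := by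
  let C : Sym2 (CP 3 l).edgeSet → Fin 3 := Sym2.lift
    ⟨fun e e' => ⟨pairColor (edgeIndex e) (edgeIndex e'), pairColor_lt _ _⟩,
      fun _ _ => Fin.ext (pairColor_comm _ _)⟩
  refine ⟨Coloring.mk (fun E => C E.1) fun {E E'} h => ?_⟩
  obtain ⟨hne, e, he, he'⟩ := lineGraph_adj_iff_exists.1 h
  obtain ⟨E, hE⟩ := E
  obtain ⟨E', hE'⟩ := E'
  obtain ⟨a, rfl⟩ := Sym2.mem_iff_exists.1 he
  obtain ⟨b, rfl⟩ := Sym2.mem_iff_exists.1 he'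
  have hab : edgeIndex a ≠ edgeIndex b :=
    edgeIndex_injective.ne fun hab => hne (Subtype.ext (Sym2.congr_right.2 hab))
  have h1 := edgeIndex_of_adj ((mem_edgeSet _).1 hE)
  have h2 := edgeIndex_of_adj ((mem_edgeSet _).1 hE')
  simp only [C, Sym2.lift_mk, ne_eq, Fin.ext_iff, pairColor]
  split_ifs <;> omega

end CP

/-! ### Transfer along isomorphisms -/

section Iso

theorem IsProlific.of_iso {V : Type*} {W : Type*} {G : SimpleGraph V} {H : SimpleGraph W}
    (e : G ≃g H) (h : IsProlific H) : IsProlific G := by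
  obtain ⟨hfin, hconn, hpath, hcycle, hstar⟩ := h
  exact ⟨Finite.of_equiv _ e.toEquiv.symm, e.connected_iff.2 hconn,
    fun n => ⟨fun f => (hpath n).false (e.symm.trans f)⟩,
    fun n hn => ⟨fun f => (hcycle n hn).false (e.symm.trans f)⟩,
    ⟨fun f => hstar.false (e.symm.trans f)⟩⟩

/-- Stated up to isomorphism so that it covers copies of CP(3, l) in any universe. -/
theorem ind_chi_eq_three_of_iso_CP_three {V : Type u} {G : SimpleGraph V} {l : ℕ} (hl : 1 ≤ l)
    (e : G ≃g CP 3 l) : ind chi ⟨V, G⟩ = 3 := by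
  refine le_antisymm ((CP_three_isProlific hl).of_iso e).ind_chi_le_three (le_sInf ?_)
  rintro _ ⟨r, hr, rfl⟩
  by_contra! hlt
  have hr3 : r < 3 := by exact_mod_cast hlt
  have hG : 3 ≤ chi ⟨V, G⟩ :=
    three_le_chromaticNumber_CP_three.trans_eq (chromaticNumber_congr e).symm
  have hr' : chi ⟨V, G⟩ < chi (iterLine ⟨V, G⟩ r) := hr
  interval_cases r
  · exact hr'.false
  · have : chi (iterLine ⟨V, G⟩ 1) ≤ 3 := (chromaticNumber_congr e.lineGraph).trans_le
      colorable_lineGraph_CP_three.chromaticNumber_le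
    exact (hr'.trans_le (this.trans hG)).false
  · have : chi (iterLine ⟨V, G⟩ 2) ≤ 3 := (chromaticNumber_congr e.lineGraph.lineGraph).trans_le
      colorable_lineGraph_lineGraph_CP_three.chromaticNumber_le
    exact (hr'.trans_le (this.trans hG)).false

end Iso

end LineIndex

theorem theoremH :
    (∀ (V : Type u) (G : SimpleGraph V), LineIndex.IsProlific G →
      LineIndex.ind LineIndex.chi ⟨V, G⟩ ≤ 3) ∧
    (∀ n : ℕ, 4 ≤ n → LineIndex.IsProlific (LineIndex.CP 3 (n - 3)) ∧
      LineIndex.ind LineIndex.chi ⟨_, LineIndex.CP 3 (n - 3)⟩ = 3) ∧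
    {n : ℕ | ∃ G : SimpleGraph (Fin n), LineIndex.IsProlific G ∧
      LineIndex.ind LineIndex.chi ⟨_, G⟩ = 3}.Infinite ∧
    LineIndex.familyIndex LineIndex.chi LineIndex.prolificGraphs.{u} = 3 := by
  have hCP : ∀ l : ℕ, 1 ≤ l → LineIndex.IsProlific (LineIndex.CP 3 l) ∧
      LineIndex.ind LineIndex.chi ⟨_, LineIndex.CP 3 l⟩ = 3 := fun l hl =>
    ⟨LineIndex.CP_three_isProlific hl,
      LineIndex.ind_chi_eq_three_of_iso_CP_three hl SimpleGraph.Iso.refl⟩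
  refine ⟨fun V G h => h.ind_chi_le_three, fun n hn => hCP _ (by omega), ?_, le_antisymm ?_ ?_⟩
  -- Different orders make the graphs pairwise non-isomorphic.
  · refine Set.infinite_of_injective_forall_mem (f := fun m : ℕ => 3 + (m + 1))
      (fun a b h => by simpa using h) fun m => ⟨LineIndex.CP 3 (m + 1), hCP _ (by omega)⟩
  · exact iSup₂_le fun G hG => LineIndex.IsProlific.ind_chi_le_three hG
  · let e : (LineIndex.CP 3 1).comap (Equiv.ulift.{u} : ULift (Fin (3 + 1)) ≃ _) ≃g
        LineIndex.CP 3 1 := SimpleGraph.Iso.comap Equiv.ulift _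
    have hmem : (⟨_, (LineIndex.CP 3 1).comap (Equiv.ulift.{u} : ULift (Fin (3 + 1)) ≃ _)⟩ :
        LineIndex.Graph.{u}) ∈ LineIndex.prolificGraphs.{u} :=
      (hCP 1 le_rfl).1.of_iso e
    exact (LineIndex.ind_chi_eq_three_of_iso_CP_three le_rfl e).ge.trans
      (le_iSup₂ (f := fun G (_ : G ∈ LineIndex.prolificGraphs.{u}) =>
        LineIndex.ind LineIndex.chi G) _ hmem)
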